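/- For an orthonormal basis $b=(|b_k\rangle)$ of $\mathbb C^n$ let $P_k=|b_k\rangle\langle b_k|$; the associated complete projective measurement is the map $\Pi[\sigma]=\sum_k P_k\sigma P_k$. On $\mathbb C^{d_A}\otimes\mathbb C^{d_B}$ a complete one-sided measurement is $\Pi_A[\sigma]=\sum_j (P_j\otimes 1)\sigma(P_j\otimes 1)$ with $P_j$ the projectors of an orthonormal basis of $\mathbb C^{d_A}$, and a complete two-sided measurement is $(\Pi_A\otimes\Pi_B)[\sigma]=\sum_{j,k}(P_j\otimes R_k)\sigma(P_j\otimes R_k)$ with $P_j$, $R_k$ the projectors of orthonormal bases of $\mathbb C^{d_A}$ and $\mathbb C^{d_B}$. Let $D_1[\sigma,\tau]=\tfrac12\|\sigma-\tau\|_1$ with $\|X\|_1=\mathrm{Tr}\sqrt{X^\dagger X}$, and let $\mathrm d\psi$ be the Haar-uniform probability distribution of unit vectors of the Hilbert space considered (the law of $U\psi_0$, with $U$ a Haar-random unitary and $\psi_0$ a fixed unit vector). For a set $\mathcal L$ of such maps put $$Q_{D_1,\mathcal L}(\mathcal E_{\rm Haar})=\inf_{\Lambda\in\mathcal L}\int \mathrm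 d\psi\; D_1\big[|\psi\rangle\langle\psi|,\Lambda[|\psi\rangle\langle\psi|]\big].$$ Let $d,d_A,d_B\ge 1$ be integers. In each of the three cases below the function $\psi\mapsto D_1\big[|\psi\rangle\langle\psi|,\Lambda[|\psi\rangle\langle\psi|]\big]$ is integrable for every $\Lambda\in\mathcal L$, its integral is the same for all $\Lambda\in\mathcal L$ (hence equal to $Q_{D_1,\mathcal L}(\mathcal E_{\rm Haar})$), and the infimum is attained. Moreover: 1. (single system $\mathbb C^d$, all complete projective measurements) $$1-\frac{2}{d+1}\le Q_{D_1,\{\Pi\}}(\mathcal E_{\rm Haar})\le\sqrt{1-\frac{2}{d+1}};$$ 2. (bipartite system $\mathbb C^{d_A}\otimes\mathbb C^{d_B}$, all complete one-sided measurements) $$1-\frac{d_B+1}{d_Ad_B+1}\le Q_{D_1,\{\Pi_A\}}(\mathcal E_{\rm Haar})\le\sqrt{1-\frac{d_B+1}{d_Ad_B+1}};$$ 3. (bipartite system $\mathbb C^{d_A}\otimes\mathbb C^{d_B}$, all complete two-sided measurements) $$1-\frac{2}{d_Ad_B+1}\le Q_{D_1,\{\Pi_A\otimes\Pi_B\}}(\mathcal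 E_{\rm Haar})\le\sqrt{1-\frac{2}{d_Ad_B+1}}.$$ Finally, as the dimension tends to infinity, the upper bound in 1 satisfies $\sqrt{1-\frac{2}{d+1}}=1-\frac1{d+1}+O(d^{-2})$. -/

import Mathlib

open MeasureTheory
open scoped Matrix Kronecker MatrixOrder

namespace HaarDisturbance

section Basic

variable {n : Type*} [Fintype n] [DecidableEq n]

/-- The trace norm `‖X‖₁ = Tr √(X† X)`. -/
noncomputable def traceNorm (X : Matrix n n ℂ) : ℝ :=
  (CFC.sqrt (Xᴴ * X)).trace.re

/-- The trace distance `D₁[σ, τ] = ‖σ - τ‖₁ / 2`. -/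
noncomputable def traceDist (σ τ : Matrix n n ℂ) : ℝ :=
  1 / 2 * traceNorm (σ - τ)

/-- The operator `|ψ⟩⟨ψ|`. -/
def pureState (ψ : n → ℂ) : Matrix n n ℂ :=
  Matrix.vecMulVec ψ (star ψ)

/-- The rank-one projector `|b k⟩⟨b k|` onto a vector of an orthonormal basis. -/
noncomputable def basisProj (b : OrthonormalBasis n ℂ (EuclideanSpace ℂ n)) (k : n) :
    Matrix n n ℂ :=
  pureState (fun i => b k i)

/-- The nonselective action `σ ↦ ∑ₖ Pₖ σ Pₖ` of the projectors `Pₖ`. -/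
def measureMap {κ : Type*} [Fintype κ] (P : κ → Matrix n n ℂ) (σ : Matrix n n ℂ) :
    Matrix n n ℂ :=
  ∑ k, P k * σ * P k

/-- The complete projective measurements on `ℂⁿ`. -/
def completeMeasurements (n : Type*) [Fintype n] [DecidableEq n] :
    Set (Matrix n n ℂ → Matrix n n ℂ) :=
  {Λ | ∃ b : OrthonormalBasis n ℂ (EuclideanSpace ℂ n), Λ = measureMap (basisProj b)}

/-- The complete projective measurements on the first factor of `ℂᵃ ⊗ ℂᵇ`. -/
def localMeasurements (a b : Type*) [Fintype a] [DecidableEq a] [Fintype b] [DecidableEq b] :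
    Set (Matrix (a × b) (a × b) ℂ → Matrix (a × b) (a × b) ℂ) :=
  {Λ | ∃ u : OrthonormalBasis a ℂ (EuclideanSpace ℂ a),
    Λ = measureMap fun j : a => basisProj u j ⊗ₖ (1 : Matrix b b ℂ)}

/-- The complete bilocal projective measurements on `ℂᵃ ⊗ ℂᵇ`. -/
def bilocalMeasurements (a b : Type*) [Fintype a] [DecidableEq a] [Fintype b] [DecidableEq b] :
    Set (Matrix (a × b) (a × b) ℂ → Matrix (a × b) (a × b) ℂ) :=
  {Λ | ∃ (u : OrthonormalBasis a ℂ (EuclideanSpace ℂ a))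
      (v : OrthonormalBasis b ℂ (EuclideanSpace ℂ b)),
    Λ = measureMap fun k : a × b => basisProj u k.1 ⊗ₖ basisProj v k.2}

/-- The disturbance, in trace distance, of the pure state `|ψ⟩⟨ψ|` under `Λ`. -/
noncomputable def disturbance (Λ : Matrix n n ℂ → Matrix n n ℂ) (ψ : n → ℂ) : ℝ :=
  traceDist (pureState ψ) (Λ (pureState ψ))

/-- The average disturbance of the ensemble of pure states `ψ` with law `μ` under `Λ`. -/
noncomputable def avgDisturbance (μ : Measure (n → ℂ)) (Λ : Matrix n n ℂ → Matrix n n ℂ) : ℝ :=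
  ∫ ψ, disturbance Λ ψ ∂μ

/-- The quantumness `Q_{D₁, L}` of the ensemble of pure states with law `μ`, under the class `L`
of operations: the infimum of the average disturbance. -/
noncomputable def quantumness (μ : Measure (n → ℂ)) (L : Set (Matrix n n ℂ → Matrix n n ℂ)) : ℝ :=
  sInf (avgDisturbance μ '' L)

end Basic

section Haar

variable (n : Type*) [Fintype n] [DecidableEq n]

noncomputable instance instMeasurableSpaceUnitary : MeasurableSpace (Matrix.unitaryGroup n ℂ) := borel _

instance instBorelSpaceUnitary : BorelSpace (Matrix.unitaryGroup n ℂ) := ⟨rfl⟩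

instance instCompactSpaceUnitary : CompactSpace (Matrix.unitaryGroup n ℂ) := by
  refine isCompact_iff_compactSpace.mp
    (?_ : IsCompact (Matrix.unitaryGroup n ℂ : Set (Matrix n n ℂ)))
  have hK : IsCompact (Set.univ.pi fun _ : n => Set.univ.pi fun _ : n =>
      Metric.closedBall (0 : ℂ) 1) :=
    isCompact_univ_pi fun _ => isCompact_univ_pi fun _ => isCompact_closedBall _ _
  refine IsCompact.of_isClosed_subset (X := Matrix n n ℂ) hK ?_ ?_
  · exact isClosed_unitary
  · intro U hU i _ j _
    simpa using entry_norm_bound_of_unitary hU i j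

/-- The Haar measure of the unitary group `U(n)`, normalized to total mass one. -/
noncomputable def haarUnitary : Measure (Matrix.unitaryGroup n ℂ) :=
  Measure.haarMeasure ⊤

/-- The Haar-uniform ensemble of pure states of `ℂⁿ`: the law of `U e` for a Haar-random unitary
`U` and a fixed standard basis vector `e` (by unitary invariance, which one does not matter). -/
noncomputable def haarPureStates [Nonempty n] : Measure (n → ℂ) :=
  (haarUnitary n).map fun U : Matrix.unitaryGroup n ℂ =>
    (U : Matrix n n ℂ) *ᵥ Pi.single (Classical.arbitrary n) 1

end Haar

end HaarDisturbance

open HaarDisturbance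

/-!
The Haar law of `ψ` is invariant under every unitary, and rotating a measurement together with the
state does not change the disturbance. Each of the three classes is a single unitary orbit, so the
average disturbance is constant on it and may be computed for the standard basis. There the
measurement is a pinching: for a labelling `f` of the basis (`id`, or the projection to the first
factor) it keeps the entries `(i, j)` with `f i = f j` and kills the others
(`quantumness_of_unitarily_equivalent_pinching`).

Let `X = |ψ⟩⟨ψ| - Λ[|ψ⟩⟨ψ|]` and let `G ψ` be the sum of `‖ψ i‖² ‖ψ j‖²` over `f i ≠ f j`
(`blockInfidelity`). Then `Tr X = 0`, so the disturbance is the sum of the positive eigenvalues of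
`X`. It is bounded pointwise from both sides:

* from below by the expectation of `X` in the state `ψ`, which is `G ψ`
  (`re_expectation_le_half_traceNorm`);
* from above by `√(G ψ)`: `X` is a rank-one projector minus a positive operator, so it has at most
  one positive eigenvalue, whose square is at most `Tr X² = G ψ`
  (`max_eigenvalues_mul_max_eigenvalues_eq_zero`, `half_traceNorm_sq_le_trace_mul_self`).

Jensen's inequality turns these into bounds of the average by `∫ G` and `√(∫ G)`. The integral of
`G` follows from the second moments of the probabilities `‖ψ i‖²`
(`integral_norm_sq_mul_norm_sq`). By invariance the fourth moment of `⟨e|ψ⟩` depends on `‖e‖` only;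
applied to `e i + ω e j` with `ω` running over the fourth roots of unity this says that
`𝔼 ‖ψ i‖⁴ = 2 𝔼 ‖ψ i‖² ‖ψ j‖²` for `i ≠ j`, and normalization fixes the common value.
-/

namespace HaarDisturbance

section TraceNormAndEnsemble

variable {n : Type*} [Fintype n] [DecidableEq n]

/-! ### The trace norm -/

open scoped Matrix.Norms.L2Operator in
lemma continuous_traceNorm : Continuous (traceNorm : Matrix n n ℂ → ℝ) := by
  have h : Continuous fun X : Matrix n n ℂ => CFC.sqrt (Xᴴ * X) := by
    refine Continuous.cfcₙ_nnreal_of_mem_nhdsSet (s := Set.univ) NNReal.sqrt Filter.univ_mem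
      (by fun_prop) (fun X => ?_) NNReal.continuous_sqrt.continuousOn (by simp)
    exact star_mul_self_nonneg X
  exact Complex.continuous_re.comp h.matrix_trace

lemma traceNorm_conj_unitary (V : Matrix.unitaryGroup n ℂ) (X : Matrix n n ℂ) :
    traceNorm ((V : Matrix n n ℂ) * X * (V : Matrix n n ℂ)ᴴ) = traceNorm X := by
  have hV : (V : Matrix n n ℂ)ᴴ * (V : Matrix n n ℂ) = 1 := Unitary.coe_star_mul_self V
  have hs : CFC.sqrt (Xᴴ * X) * CFC.sqrt (Xᴴ * X) = Xᴴ * X :=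
    CFC.sqrt_mul_sqrt_self _ (star_mul_self_nonneg X)
  have key : CFC.sqrt (((V : Matrix n n ℂ) * X * (V : Matrix n n ℂ)ᴴ)ᴴ *
      ((V : Matrix n n ℂ) * X * (V : Matrix n n ℂ)ᴴ)) =
      (V : Matrix n n ℂ) * CFC.sqrt (Xᴴ * X) * (V : Matrix n n ℂ)ᴴ := by
    refine CFC.sqrt_unique ?_ (star_right_conjugate_nonneg (CFC.sqrt_nonneg _) _)
    calc _ = (V : Matrix n n ℂ) * CFC.sqrt (Xᴴ * X) * ((V : Matrix n n ℂ)ᴴ *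
            (V : Matrix n n ℂ)) * CFC.sqrt (Xᴴ * X) * (V : Matrix n n ℂ)ᴴ := by
          simp only [mul_assoc]
      _ = (V : Matrix n n ℂ) * Xᴴ * ((V : Matrix n n ℂ)ᴴ *
            (V : Matrix n n ℂ)) * X * (V : Matrix n n ℂ)ᴴ := by
          rw [hV, mul_one, mul_one, mul_assoc (V : Matrix n n ℂ), hs]
          simp only [mul_assoc]
      _ = _ := by
          simp only [Matrix.conjTranspose_mul, Matrix.conjTranspose_conjTranspose, mul_assoc]
  rw [traceNorm, key, Matrix.trace_mul_comm, ← mul_assoc, hV, one_mul, traceNorm]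

open scoped ComplexOrder in
lemma traceNorm_eq_sum_abs_eigenvalues {X : Matrix n n ℂ} (hX : X.IsHermitian) :
    traceNorm X = ∑ i, |hX.eigenvalues i| := by
  set U := hX.eigenvectorUnitary
  have hU : (U : Matrix n n ℂ)ᴴ * (U : Matrix n n ℂ) = 1 := Unitary.coe_star_mul_self U
  set D : Matrix n n ℂ := Matrix.diagonal fun i => (hX.eigenvalues i : ℂ) with hD
  have hXU : X = (U : Matrix n n ℂ) * D * (U : Matrix n n ℂ)ᴴ := by
    conv_lhs => rw [hX.spectral_theorem, Unitary.conjStarAlgAut_apply]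
    rfl
  have hsqrt : CFC.sqrt (Dᴴ * D) = Matrix.diagonal fun i => ((|hX.eigenvalues i| : ℝ) : ℂ) := by
    refine CFC.sqrt_unique ?_ ?_
    · rw [hD, Matrix.diagonal_conjTranspose, Matrix.diagonal_mul_diagonal,
        Matrix.diagonal_mul_diagonal]
      congr 1
      funext i
      simp only [Pi.star_apply, RCLike.star_def, Complex.conj_ofReal]
      rw [← Complex.ofReal_mul, abs_mul_abs_self, Complex.ofReal_mul]
    · rw [Matrix.nonneg_iff_posSemidef]
      exact Matrix.PosSemidef.diagonal fun i => by
        simp only [Pi.zero_apply]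
        exact_mod_cast abs_nonneg _
  have h1 : traceNorm X = traceNorm D := by
    conv_lhs => rw [hXU]
    exact traceNorm_conj_unitary U D
  rw [h1, traceNorm, hsqrt, Matrix.trace_diagonal, ← Complex.ofReal_sum, Complex.ofReal_re]

/-! ### The Haar-uniform ensemble -/

instance isProbabilityMeasure_haarUnitary : IsProbabilityMeasure (haarUnitary n) :=
  ⟨by
    have h := Measure.haarMeasure_self (K₀ := (⊤ : TopologicalSpace.PositiveCompacts
      (Matrix.unitaryGroup n ℂ)))
    simpa [haarUnitary] using h⟩

lemma haarUnitary_map_mul_left (V : Matrix.unitaryGroup n ℂ) :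
    (haarUnitary n).map (fun U => V * U) = haarUnitary n :=
  Measure.IsMulLeftInvariant.map_mul_left_eq_self (μ := Measure.haarMeasure ⊤) V

lemma continuous_unitary_mulVec (v : n → ℂ) :
    Continuous fun U : Matrix.unitaryGroup n ℂ => (U : Matrix n n ℂ) *ᵥ v :=
  continuous_subtype_val.matrix_mulVec continuous_const

lemma sum_norm_sq_unitary_mulVec (V : Matrix.unitaryGroup n ℂ) (ψ : n → ℂ) :
    ∑ i, ‖((V : Matrix n n ℂ) *ᵥ ψ) i‖ ^ 2 = ∑ i, ‖ψ i‖ ^ 2 := by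
  have h (φ : n → ℂ) : ((∑ i, ‖φ i‖ ^ 2 : ℝ) : ℂ) = star φ ⬝ᵥ φ := by
    simp [dotProduct, Complex.conj_mul']
  have hV : (V : Matrix n n ℂ)ᴴ * (V : Matrix n n ℂ) = 1 := Unitary.coe_star_mul_self V
  apply Complex.ofReal_injective
  rw [h, h, Matrix.star_mulVec, Matrix.dotProduct_mulVec, Matrix.vecMul_vecMul, hV,
    Matrix.vecMul_one]

variable [Nonempty n]

instance isProbabilityMeasure_haarPureStates : IsProbabilityMeasure (haarPureStates n) :=
  Measure.isProbabilityMeasure_map (continuous_unitary_mulVec _).measurable.aemeasurable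

lemma measurePreserving_unitary_mulVec (V : Matrix.unitaryGroup n ℂ) :
    MeasurePreserving (fun ψ : n → ℂ => (V : Matrix n n ℂ) *ᵥ ψ)
      (haarPureStates n) (haarPureStates n) := by
  have hc : Continuous fun ψ : n → ℂ => (V : Matrix n n ℂ) *ᵥ ψ :=
    continuous_const.matrix_mulVec continuous_id
  refine ⟨hc.measurable, ?_⟩
  have hm : Measurable fun U : Matrix.unitaryGroup n ℂ => V * U :=
    (continuous_const.mul continuous_id).measurable
  conv_rhs => rw [haarPureStates, ← haarUnitary_map_mul_left V]
  rw [haarPureStates, Measure.map_map hc.measurable (continuous_unitary_mulVec _).measurable,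
    Measure.map_map (continuous_unitary_mulVec _).measurable hm]
  congr 1
  funext U
  simp only [Function.comp_apply, Matrix.mulVec_mulVec, Submonoid.coe_mul]

lemma ae_sum_norm_sq_eq_one : ∀ᵐ ψ ∂haarPureStates n, ∑ i, ‖ψ i‖ ^ 2 = 1 := by
  have hc : Continuous fun ψ : n → ℂ => ∑ i, ‖ψ i‖ ^ 2 := by fun_prop
  rw [haarPureStates, ae_map_iff (continuous_unitary_mulVec _).measurable.aemeasurable
    (measurableSet_eq_fun hc.measurable measurable_const)]
  refine Filter.Eventually.of_forall fun U => ?_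
  rw [sum_norm_sq_unitary_mulVec, Finset.sum_eq_single (Classical.arbitrary n)]
  · simp
  · intro i _ hi
    simp [Pi.single_eq_of_ne hi]
  · simp

end TraceNormAndEnsemble

section Moments

variable {n : Type*} [Fintype n] [DecidableEq n]

/-! ### Unitaries attached to orthonormal bases -/

lemma basisMatrix_mem_unitaryGroup (b : OrthonormalBasis n ℂ (EuclideanSpace ℂ n)) :
    (Matrix.of fun i k => b k i : Matrix n n ℂ) ∈ Matrix.unitaryGroup n ℂ := by
  rw [Matrix.mem_unitaryGroup_iff']
  ext k l
  have h := orthonormal_iff_ite.mp b.orthonormal k l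
  rw [PiLp.inner_apply] at h
  simpa [Matrix.mul_apply, Matrix.one_apply, Matrix.star_eq_conjTranspose, mul_comm] using h

/-- The unitary matrix whose columns are the vectors of the orthonormal basis `b`. -/
noncomputable def basisUnitary (b : OrthonormalBasis n ℂ (EuclideanSpace ℂ n)) :
    Matrix.unitaryGroup n ℂ :=
  ⟨Matrix.of fun i k => b k i, basisMatrix_mem_unitaryGroup b⟩

lemma basisProj_eq_conj (b : OrthonormalBasis n ℂ (EuclideanSpace ℂ n)) (k : n) :
    basisProj b k = (basisUnitary b : Matrix n n ℂ) * Matrix.diagonal (Pi.single k 1) *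
      (basisUnitary b : Matrix n n ℂ)ᴴ := by
  ext i j
  rw [Matrix.mul_apply, Finset.sum_eq_single k]
  · simp [basisProj, pureState, basisUnitary, Matrix.vecMulVec_apply]
  · intro l _ hl
    simp [Pi.single_eq_of_ne hl]
  · simp

/-- A unit vector `e` extends to an orthonormal basis, so some unitary turns the amplitude along `e`
into a coordinate. -/
lemma exists_unitary_mulVec_apply_eq_dotProduct (e : n → ℂ) (he : ∑ i, ‖e i‖ ^ 2 = 1) (k : n) :
    ∃ V : Matrix.unitaryGroup n ℂ, ∀ ψ : n → ℂ,
      ((V : Matrix n n ℂ) *ᵥ ψ) k = star e ⬝ᵥ ψ := by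
  have hnorm : ‖(WithLp.toLp 2 e : EuclideanSpace ℂ n)‖ = 1 := by
    rw [EuclideanSpace.norm_eq]
    simp [he]
  have hv : Orthonormal ℂ (({k} : Set n).domRestrict
      fun _ => (WithLp.toLp 2 e : EuclideanSpace ℂ n)) := by
    refine ⟨fun _ => hnorm, fun i j hij => (hij (Subsingleton.elim i j)).elim⟩
  obtain ⟨b, hb⟩ := hv.exists_orthonormalBasis_extension_of_card_eq (by simp)
  refine ⟨star (basisUnitary b), fun ψ => ?_⟩
  have hbk := hb k rfl
  simp [Matrix.mulVec, dotProduct, basisUnitary, hbk, Matrix.star_apply]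

/-! ### Second moments of the Haar-uniform ensemble -/

lemma norm_sq_apply_le_one {n : Type*} [Fintype n] {ψ : n → ℂ} (hψ : ∑ i, ‖ψ i‖ ^ 2 = 1)
    (i : n) : ‖ψ i‖ ^ 2 ≤ 1 :=
  hψ ▸ Finset.single_le_sum (f := fun i => ‖ψ i‖ ^ 2) (fun _ _ => by positivity)
    (Finset.mem_univ i)

variable [Nonempty n]

lemma integrable_haarPureStates_of_bound {g : (n → ℂ) → ℝ} (hg : Continuous g) (C : ℝ)
    (hC : ∀ ψ : n → ℂ, ∑ i, ‖ψ i‖ ^ 2 = 1 → |g ψ| ≤ C) : Integrable g (haarPureStates n) :=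
  Integrable.of_bound hg.aestronglyMeasurable C
    (ae_sum_norm_sq_eq_one.mono fun ψ hψ => hC ψ hψ)

lemma integrable_norm_sq_mul_norm_sq (i j : n) :
    Integrable (fun ψ => ‖ψ i‖ ^ 2 * ‖ψ j‖ ^ 2) (haarPureStates n) := by
  refine integrable_haarPureStates_of_bound (by fun_prop) 1 fun ψ hψ => ?_
  rw [abs_of_nonneg (by positivity)]
  exact mul_le_one₀ (norm_sq_apply_le_one hψ i) (by positivity) (norm_sq_apply_le_one hψ j)

lemma integral_comp_unitary_mulVec (V : Matrix.unitaryGroup n ℂ) {g : (n → ℂ) → ℝ}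
    (hg : Continuous g) :
    ∫ ψ, g ((V : Matrix n n ℂ) *ᵥ ψ) ∂haarPureStates n = ∫ ψ, g ψ ∂haarPureStates n := by
  have h := measurePreserving_unitary_mulVec V
  conv_rhs => rw [← h.map_eq]
  rw [integral_map h.measurable.aemeasurable hg.aestronglyMeasurable]

lemma integrable_norm_dotProduct_pow_four (e : n → ℂ) :
    Integrable (fun ψ => ‖star e ⬝ᵥ ψ‖ ^ 4) (haarPureStates n) := by
  refine integrable_haarPureStates_of_bound
    ((continuous_const.dotProduct continuous_id).norm.pow 4) ((∑ i, ‖e i‖) ^ 4) fun ψ hψ => ?_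
  rw [abs_of_nonneg (by positivity)]
  gcongr
  refine (norm_sum_le _ _).trans (Finset.sum_le_sum fun i _ => ?_)
  rw [norm_mul, Pi.star_apply, norm_star]
  exact mul_le_of_le_one_right (norm_nonneg _)
    ((sq_le_one_iff₀ (norm_nonneg _)).mp (norm_sq_apply_le_one hψ i))

/-- By unitary invariance the fourth moment of an amplitude depends on the norm of `e` only. -/
lemma integral_norm_dotProduct_pow_four (e : n → ℂ) (k : n) :
    ∫ ψ, ‖star e ⬝ᵥ ψ‖ ^ 4 ∂haarPureStates n =
      (∑ i, ‖e i‖ ^ 2) ^ 2 * ∫ ψ, ‖ψ k‖ ^ 4 ∂haarPureStates n := by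
  set s := ∑ i, ‖e i‖ ^ 2 with hs
  have hs0 : 0 ≤ s := Finset.sum_nonneg fun _ _ => by positivity
  rcases hs0.eq_or_lt with h0 | h0
  · have he : e = 0 := by
      funext i
      have := (Finset.sum_eq_zero_iff_of_nonneg fun i _ => by positivity).mp (hs ▸ h0.symm) i
        (Finset.mem_univ i)
      simpa using this
    simp [he, ← h0]
  · have hr : (0 : ℝ) < √s := Real.sqrt_pos.mpr h0
    obtain ⟨V, hV⟩ := exists_unitary_mulVec_apply_eq_dotProduct
      (((√s)⁻¹ : ℂ) • e) (by
        simp only [Pi.smul_apply, smul_eq_mul, norm_mul, mul_pow, ← Finset.mul_sum, ← hs]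
        rw [norm_inv, Complex.norm_real, Real.norm_of_nonneg hr.le, inv_pow, Real.sq_sqrt hs0]
        exact inv_mul_cancel₀ h0.ne') k
    rw [← integral_comp_unitary_mulVec V (g := fun ψ => ‖ψ k‖ ^ 4) (by fun_prop),
      ← integral_const_mul]
    congr 1
    funext ψ
    rw [hV, star_smul, smul_dotProduct, norm_smul, mul_pow, norm_star, norm_inv,
      Complex.norm_real, Real.norm_of_nonneg hr.le, inv_pow,
      show (√s) ^ 4 = s ^ 2 by rw [← Real.sq_sqrt hs0, ← pow_mul, Real.sq_sqrt hs0]]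
    field_simp

/-- Averaging over the fourth roots of unity removes the interference terms. -/
lemma sum_norm_add_root_mul_pow_four (a b : ℂ) :
    ‖a + b‖ ^ 4 + ‖a - b‖ ^ 4 + ‖a + Complex.I * b‖ ^ 4 + ‖a - Complex.I * b‖ ^ 4 =
      4 * (‖a‖ ^ 4 + ‖b‖ ^ 4 + 4 * (‖a‖ ^ 2 * ‖b‖ ^ 2)) := by
  have h (z : ℂ) : ‖z‖ ^ 4 = (z.re * z.re + z.im * z.im) ^ 2 := by
    rw [← Complex.normSq_apply, ← Complex.sq_norm]; ring
  have h2 (z : ℂ) : ‖z‖ ^ 2 = z.re * z.re + z.im * z.im := by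
    rw [← Complex.normSq_apply, ← Complex.sq_norm]
  simp only [h, h2, Complex.add_re, Complex.add_im, Complex.sub_re, Complex.sub_im,
    Complex.mul_re, Complex.mul_im, Complex.I_re, Complex.I_im]
  ring

lemma integral_norm_pow_four_eq (i k : n) :
    ∫ ψ, ‖ψ i‖ ^ 4 ∂haarPureStates n = ∫ ψ, ‖ψ k‖ ^ 4 ∂haarPureStates n := by
  have h := integral_norm_dotProduct_pow_four (Pi.single i 1 : n → ℂ) k
  have hs : ∑ j, ‖(Pi.single i 1 : n → ℂ) j‖ ^ 2 = 1 := by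
    rw [Finset.sum_eq_single i] <;> simp +contextual
  rw [hs] at h
  simpa [Pi.star_single] using h

/-- Invariance applied to the vectors `e i + ω e j` with `ω ^ 4 = 1`. -/
lemma two_mul_integral_norm_sq_mul_norm_sq {i j : n} (hij : i ≠ j) (k : n) :
    2 * ∫ ψ, ‖ψ i‖ ^ 2 * ‖ψ j‖ ^ 2 ∂haarPureStates n = ∫ ψ, ‖ψ k‖ ^ 4 ∂haarPureStates n := by
  have hint (i : n) : Integrable (fun ψ => ‖ψ i‖ ^ 4) (haarPureStates n) := by
    refine (integrable_norm_sq_mul_norm_sq i i).congr (Filter.Eventually.of_forall fun ψ => ?_)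
    ring
  have key (z : ℂ) (hz : ‖z‖ = 1) :
      Integrable (fun ψ => ‖ψ i + z * ψ j‖ ^ 4) (haarPureStates n) ∧
      ∫ ψ, ‖ψ i + z * ψ j‖ ^ 4 ∂haarPureStates n =
        4 * ∫ ψ, ‖ψ k‖ ^ 4 ∂haarPureStates n := by
    set e : n → ℂ := Pi.single i 1 + Pi.single j (star z) with he
    have hs : ∑ l, ‖e l‖ ^ 2 = 2 := by
      rw [Fintype.sum_eq_add i j hij fun l hl => by simp [he, hl.1, hl.2]]
      simp [he, hij, hij.symm, hz]
      norm_num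
    have hdot (ψ : n → ℂ) : star e ⬝ᵥ ψ = ψ i + z * ψ j := by
      simp [he, star_add, Pi.star_single, add_dotProduct]
    have h1 := integrable_norm_dotProduct_pow_four e
    have h2 := integral_norm_dotProduct_pow_four e k
    simp only [hdot, hs] at h1 h2
    exact ⟨h1, by rw [h2]; norm_num⟩
  obtain ⟨i1, e1⟩ := key 1 (by simp)
  obtain ⟨i2, e2⟩ := key (-1) (by simp)
  obtain ⟨i3, e3⟩ := key Complex.I (by simp)
  obtain ⟨i4, e4⟩ := key (-Complex.I) (by simp)
  simp only [one_mul, neg_mul, ← sub_eq_add_neg] at i1 e1 i2 e2 i3 e3 i4 e4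
  have hsum : ∫ ψ, (‖ψ i + ψ j‖ ^ 4 + ‖ψ i - ψ j‖ ^ 4 + ‖ψ i + Complex.I * ψ j‖ ^ 4 +
      ‖ψ i - Complex.I * ψ j‖ ^ 4) ∂haarPureStates n =
      16 * ∫ ψ, ‖ψ k‖ ^ 4 ∂haarPureStates n := by
    have i12 : Integrable (fun ψ => ‖ψ i + ψ j‖ ^ 4 + ‖ψ i - ψ j‖ ^ 4) (haarPureStates n) :=
      i1.add i2
    have i123 : Integrable (fun ψ => ‖ψ i + ψ j‖ ^ 4 + ‖ψ i - ψ j‖ ^ 4 +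
        ‖ψ i + Complex.I * ψ j‖ ^ 4) (haarPureStates n) := i12.add i3
    rw [integral_add i123 i4, integral_add i12 i3, integral_add i1 i2, e1, e2, e3, e4]
    ring
  simp only [sum_norm_add_root_mul_pow_four] at hsum
  have hij4 : Integrable (fun ψ => ‖ψ i‖ ^ 4 + ‖ψ j‖ ^ 4) (haarPureStates n) :=
    (hint i).add (hint j)
  rw [integral_const_mul, integral_add hij4
    ((integrable_norm_sq_mul_norm_sq i j).const_mul 4), integral_add (hint i) (hint j),
    integral_const_mul, integral_norm_pow_four_eq i k, integral_norm_pow_four_eq j k] at hsum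
  linarith

/-- The second moments of the probabilities `‖ψ i‖ ^ 2`: they are those of the uniform
distribution on the simplex. -/
lemma integral_norm_sq_mul_norm_sq (i j : n) :
    ∫ ψ, ‖ψ i‖ ^ 2 * ‖ψ j‖ ^ 2 ∂haarPureStates n =
      (1 + if i = j then 1 else 0) / (Fintype.card n * (Fintype.card n + 1)) := by
  set m := ∫ ψ, ‖ψ i‖ ^ 4 ∂haarPureStates n with hm
  have hM (k l : n) : ∫ ψ, ‖ψ k‖ ^ 2 * ‖ψ l‖ ^ 2 ∂haarPureStates n =
      (1 + if k = l then 1 else 0) * (m / 2) := by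
    split_ifs with h
    · subst h
      rw [hm, ← integral_norm_pow_four_eq k i]
      norm_num
      rw [mul_div_cancel₀ _ two_ne_zero]
      congr 1
      funext ψ
      ring
    · have := two_mul_integral_norm_sq_mul_norm_sq h i
      linarith
  have htot : ∑ k, ∑ l, ∫ ψ, ‖ψ k‖ ^ 2 * ‖ψ l‖ ^ 2 ∂haarPureStates n = 1 := by
    calc _ = ∫ ψ, ∑ k, ∑ l, ‖ψ k‖ ^ 2 * ‖ψ l‖ ^ 2 ∂haarPureStates n := by
          rw [integral_finsetSum _ fun k _ => integrable_finsetSum _ fun l _ =>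
            integrable_norm_sq_mul_norm_sq k l]
          exact Finset.sum_congr rfl fun k _ => (integral_finsetSum _ fun l _ =>
            integrable_norm_sq_mul_norm_sq k l).symm
      _ = ∫ ψ, 1 ∂haarPureStates n := by
          refine integral_congr_ae (ae_sum_norm_sq_eq_one.mono fun ψ hψ => ?_)
          simp only [← Finset.mul_sum, hψ, mul_one]
      _ = 1 := by simp
  have hN : (0 : ℝ) < Fintype.card n := by exact_mod_cast Fintype.card_pos
  have hval : (m / 2) * (Fintype.card n * (Fintype.card n + 1)) = 1 := by
    simp only [hM, ← Finset.sum_mul, Finset.sum_add_distrib, Finset.sum_ite_eq, Finset.mem_univ,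
      if_true, Finset.sum_const, Finset.card_univ, nsmul_eq_mul, mul_one] at htot
    linarith
  rw [hM, eq_div_iff (by positivity), mul_assoc, hval, mul_one]

end Moments

section Pinching

variable {n : Type*} [Fintype n] [DecidableEq n]

/-! ### Spectral estimates for traceless Hermitian matrices -/

lemma star_dotProduct_mulVec_eq_sum_eigenvalues {X : Matrix n n ℂ} (hX : X.IsHermitian)
    (w : n → ℂ) :
    star w ⬝ᵥ (X *ᵥ w) = ((∑ i, hX.eigenvalues i *
      ‖((hX.eigenvectorUnitary : Matrix n n ℂ)ᴴ *ᵥ w) i‖ ^ 2 : ℝ) : ℂ) := by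
  set U := hX.eigenvectorUnitary
  have hXU : X = (U : Matrix n n ℂ) * (Matrix.diagonal fun i => (hX.eigenvalues i : ℂ)) *
      (U : Matrix n n ℂ)ᴴ := by
    conv_lhs => rw [hX.spectral_theorem, Unitary.conjStarAlgAut_apply]
    rfl
  have hs : star w ᵥ* (U : Matrix n n ℂ) = star ((U : Matrix n n ℂ)ᴴ *ᵥ w) := by
    rw [Matrix.star_mulVec, Matrix.conjTranspose_conjTranspose]
  conv_lhs => rw [hXU]
  rw [← Matrix.mulVec_mulVec, ← Matrix.mulVec_mulVec, Matrix.dotProduct_mulVec, hs]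
  simp only [dotProduct, Matrix.mulVec_diagonal, Pi.star_apply, RCLike.star_def,
    Complex.ofReal_sum, Complex.ofReal_mul, Complex.ofReal_pow]
  refine Finset.sum_congr rfl fun i _ => ?_
  rw [← Complex.conj_mul']
  ring

lemma trace_mul_self_eq_sum_eigenvalues_sq {X : Matrix n n ℂ} (hX : X.IsHermitian) :
    (X * X).trace = ((∑ i, hX.eigenvalues i ^ 2 : ℝ) : ℂ) := by
  set U := hX.eigenvectorUnitary
  set D : Matrix n n ℂ := Matrix.diagonal fun i => (hX.eigenvalues i : ℂ) with hD
  have hU : (U : Matrix n n ℂ)ᴴ * (U : Matrix n n ℂ) = 1 := Unitary.coe_star_mul_self U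
  have hXU : X = (U : Matrix n n ℂ) * D * (U : Matrix n n ℂ)ᴴ := by
    conv_lhs => rw [hX.spectral_theorem, Unitary.conjStarAlgAut_apply]
    rfl
  have hXX : X * X = (U : Matrix n n ℂ) * (D * D) * (U : Matrix n n ℂ)ᴴ := by
    conv_lhs => rw [hXU]
    calc _ = (U : Matrix n n ℂ) * D * ((U : Matrix n n ℂ)ᴴ * (U : Matrix n n ℂ)) * D *
          (U : Matrix n n ℂ)ᴴ := by simp only [mul_assoc]
      _ = _ := by rw [hU, mul_one, mul_assoc (U : Matrix n n ℂ)]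
  rw [hXX, Matrix.trace_mul_comm, ← mul_assoc, hU, one_mul, hD, Matrix.diagonal_mul_diagonal,
    Matrix.trace_diagonal, Complex.ofReal_sum]
  exact Finset.sum_congr rfl fun i _ => by push_cast; ring

/-- Half the trace norm of a traceless Hermitian matrix is the trace of its positive part. -/
lemma half_traceNorm_eq_sum_max {X : Matrix n n ℂ} (hX : X.IsHermitian) (h0 : X.trace = 0) :
    1 / 2 * traceNorm X = ∑ i, max (hX.eigenvalues i) 0 := by
  have ht : ∑ i, hX.eigenvalues i = 0 := by
    have h := hX.trace_eq_sum_eigenvalues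
    rw [h0] at h
    apply Complex.ofReal_injective
    rw [Complex.ofReal_sum]
    exact h.symm
  have h (x : ℝ) : max x 0 = 1 / 2 * (|x| + x) := by
    rcases le_total x 0 with hx | hx
    · rw [max_eq_right hx, abs_of_nonpos hx]; ring
    · rw [max_eq_left hx, abs_of_nonneg hx]; ring
  simp only [h]
  rw [← Finset.mul_sum, Finset.sum_add_distrib, ht, add_zero, traceNorm_eq_sum_abs_eigenvalues hX]

/-- Testing a traceless Hermitian matrix against a pure state bounds its trace norm from below. -/
lemma re_expectation_le_half_traceNorm {X : Matrix n n ℂ} (hX : X.IsHermitian)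
    (h0 : X.trace = 0) {ψ : n → ℂ} (hψ : ∑ i, ‖ψ i‖ ^ 2 = 1) :
    (star ψ ⬝ᵥ (X *ᵥ ψ)).re ≤ 1 / 2 * traceNorm X := by
  rw [star_dotProduct_mulVec_eq_sum_eigenvalues hX, Complex.ofReal_re,
    half_traceNorm_eq_sum_max hX h0]
  have hc : ∑ i, ‖((hX.eigenvectorUnitary : Matrix n n ℂ)ᴴ *ᵥ ψ) i‖ ^ 2 = 1 :=
    (sum_norm_sq_unitary_mulVec (star hX.eigenvectorUnitary) ψ).trans hψ
  refine Finset.sum_le_sum fun i _ => ?_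
  exact (mul_le_mul_of_nonneg_right (le_max_left _ 0) (by positivity)).trans
    (mul_le_of_le_one_right (le_max_right _ _) (norm_sq_apply_le_one hc i))

/-- A Hermitian form that is nonpositive on a hyperplane has at most one positive eigenvalue. -/
lemma max_eigenvalues_mul_max_eigenvalues_eq_zero {X : Matrix n n ℂ} (hX : X.IsHermitian)
    {ψ : n → ℂ} (hneg : ∀ w : n → ℂ, star ψ ⬝ᵥ w = 0 → (star w ⬝ᵥ (X *ᵥ w)).re ≤ 0)
    {i j : n} (hij : i ≠ j) :
    max (hX.eigenvalues i) 0 * max (hX.eigenvalues j) 0 = 0 := by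
  by_contra hne
  have hi : 0 < hX.eigenvalues i := by
    by_contra h
    exact hne (by rw [max_eq_right (not_lt.mp h), zero_mul])
  have hj : 0 < hX.eigenvalues j := by
    by_contra h
    exact hne (by rw [max_eq_right (not_lt.mp h), mul_zero])
  set U := hX.eigenvectorUnitary with hUdef
  have hU : (U : Matrix n n ℂ)ᴴ * (U : Matrix n n ℂ) = 1 := Unitary.coe_star_mul_self U
  set g := star ψ ᵥ* (U : Matrix n n ℂ)
  -- a nonzero combination of the two eigenvectors orthogonal to `ψ`
  obtain ⟨a, b, hab, hg⟩ : ∃ a b : ℂ, (a ≠ 0 ∨ b ≠ 0) ∧ g i * a + g j * b = 0 := by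
    by_cases h : g j = 0
    · by_cases h' : g i = 0
      · exact ⟨1, 0, Or.inl one_ne_zero, by simp [h']⟩
      · exact ⟨0, 1, Or.inr one_ne_zero, by simp [h]⟩
    · exact ⟨g j, -g i, Or.inl h, by ring⟩
  set c : n → ℂ := Pi.single i a + Pi.single j b with hc
  have hle := hneg ((U : Matrix n n ℂ) *ᵥ c) (by
    rw [Matrix.dotProduct_mulVec]
    simpa [hc, dotProduct_add] using hg)
  rw [star_dotProduct_mulVec_eq_sum_eigenvalues hX, Complex.ofReal_re, ← hUdef,
    Matrix.mulVec_mulVec, hU, Matrix.one_mulVec,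
    Fintype.sum_eq_add i j hij fun l hl => by simp [hc, hl.1, hl.2]] at hle
  simp only [hc, Pi.add_apply, Pi.single_eq_same, Pi.single_eq_of_ne hij,
    Pi.single_eq_of_ne hij.symm, add_zero, zero_add] at hle
  rcases hab with h | h
  · have : 0 < ‖a‖ := norm_pos_iff.mpr h
    have : 0 < hX.eigenvalues i * ‖a‖ ^ 2 + hX.eigenvalues j * ‖b‖ ^ 2 := by positivity
    linarith
  · have : 0 < ‖b‖ := norm_pos_iff.mpr h
    have : 0 < hX.eigenvalues i * ‖a‖ ^ 2 + hX.eigenvalues j * ‖b‖ ^ 2 := by positivity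
    linarith

/-- If the positive part has rank at most one, its trace is its Hilbert–Schmidt norm. -/
lemma half_traceNorm_sq_le_trace_mul_self {X : Matrix n n ℂ} (hX : X.IsHermitian)
    (h0 : X.trace = 0) {ψ : n → ℂ}
    (hneg : ∀ w : n → ℂ, star ψ ⬝ᵥ w = 0 → (star w ⬝ᵥ (X *ᵥ w)).re ≤ 0) :
    (1 / 2 * traceNorm X) ^ 2 ≤ (X * X).trace.re := by
  rw [half_traceNorm_eq_sum_max hX h0, trace_mul_self_eq_sum_eigenvalues_sq hX,
    Complex.ofReal_re, sq, Finset.sum_mul_sum]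
  refine Finset.sum_le_sum fun i _ => ?_
  rw [Finset.sum_eq_single i
    (fun j _ hj => max_eigenvalues_mul_max_eigenvalues_eq_zero hX hneg hj.symm) (by simp)]
  rcases le_total (hX.eigenvalues i) 0 with h | h
  · rw [max_eq_right h, zero_mul]; positivity
  · rw [max_eq_left h, sq]

/-! ### Pinchings in the standard basis -/

variable {κ : Type*} [Fintype κ] [DecidableEq κ]

/-- The projector onto the span of the standard basis vectors `e i` with `f i = k`. -/
def blockProj (f : n → κ) (k : κ) : Matrix n n ℂ :=
  Matrix.diagonal fun i => if f i = k then 1 else 0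

lemma measureMap_blockProj_apply (f : n → κ) (σ : Matrix n n ℂ) (i j : n) :
    measureMap (blockProj f) σ i j = if f i = f j then σ i j else 0 := by
  simp [measureMap, blockProj, Matrix.sum_apply, Matrix.diagonal_mul, Matrix.mul_diagonal]

/-- The probability that two independent standard-basis measurements of `ψ` have outcomes in
different blocks of `f`. For a unit vector it is `1 - ∑ₖ ⟨ψ|Pₖ|ψ⟩²`. -/
noncomputable def blockInfidelity (f : n → κ) (ψ : n → ℂ) : ℝ :=
  ∑ i, ∑ j, if f i = f j then 0 else ‖ψ i‖ ^ 2 * ‖ψ j‖ ^ 2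

lemma pureState_sub_measureMap_blockProj_apply (f : n → κ) (ψ : n → ℂ) (i j : n) :
    (pureState ψ - measureMap (blockProj f) (pureState ψ)) i j =
      if f i = f j then 0 else ψ i * star (ψ j) := by
  rw [Matrix.sub_apply, measureMap_blockProj_apply]
  split_ifs <;> simp [pureState, Matrix.vecMulVec_apply]

lemma isHermitian_pureState_sub_measureMap_blockProj (f : n → κ) (ψ : n → ℂ) :
    (pureState ψ - measureMap (blockProj f) (pureState ψ)).IsHermitian := by
  ext i j
  simp only [Matrix.conjTranspose_apply, pureState_sub_measureMap_blockProj_apply,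
    eq_comm (a := f j)]
  split_ifs <;> simp [mul_comm]

lemma trace_pureState_sub_measureMap_blockProj (f : n → κ) (ψ : n → ℂ) :
    (pureState ψ - measureMap (blockProj f) (pureState ψ)).trace = 0 :=
  Finset.sum_eq_zero fun i _ => by
    rw [Matrix.diag_apply, pureState_sub_measureMap_blockProj_apply, if_pos rfl]

lemma expectation_pureState_sub_measureMap_blockProj (f : n → κ) (ψ : n → ℂ) :
    star ψ ⬝ᵥ ((pureState ψ - measureMap (blockProj f) (pureState ψ)) *ᵥ ψ) =
      (blockInfidelity f ψ : ℂ) := by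
  simp only [dotProduct, Matrix.mulVec, pureState_sub_measureMap_blockProj_apply,
    blockInfidelity, Finset.mul_sum, Complex.ofReal_sum]
  refine Finset.sum_congr rfl fun i _ => Finset.sum_congr rfl fun j _ => ?_
  split_ifs
  · simp
  · simp only [Pi.star_apply, RCLike.star_def, Complex.ofReal_mul, Complex.ofReal_pow,
      ← Complex.conj_mul']
    ring

lemma trace_sq_pureState_sub_measureMap_blockProj (f : n → κ) (ψ : n → ℂ) :
    ((pureState ψ - measureMap (blockProj f) (pureState ψ)) *
      (pureState ψ - measureMap (blockProj f) (pureState ψ))).trace =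
      (blockInfidelity f ψ : ℂ) := by
  simp only [Matrix.trace, Matrix.diag_apply, Matrix.mul_apply,
    pureState_sub_measureMap_blockProj_apply, blockInfidelity, Complex.ofReal_sum]
  refine Finset.sum_congr rfl fun i _ => Finset.sum_congr rfl fun j _ => ?_
  by_cases h : f i = f j
  · simp [h]
  · rw [if_neg h, if_neg h, if_neg (Ne.symm h)]
    simp only [RCLike.star_def, Complex.ofReal_mul, Complex.ofReal_pow, ← Complex.conj_mul']
    ring

/-- On the orthogonal complement of `ψ` only the positive operator `∑ₖ Pₖ|ψ⟩⟨ψ|Pₖ` survives. -/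
lemma expectation_pureState_sub_measureMap_blockProj_nonpos (f : n → κ) (ψ w : n → ℂ)
    (hw : star ψ ⬝ᵥ w = 0) :
    (star w ⬝ᵥ ((pureState ψ - measureMap (blockProj f) (pureState ψ)) *ᵥ w)).re ≤ 0 := by
  have h1 : pureState ψ *ᵥ w = 0 := by
    rw [pureState, Matrix.vecMulVec_mulVec, hw]
    simp
  have h2 : star w ⬝ᵥ (measureMap (blockProj f) (pureState ψ) *ᵥ w) =
      ((∑ k, ‖∑ j, if f j = k then star (ψ j) * w j else 0‖ ^ 2 : ℝ) : ℂ) := by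
    have hk (k : κ) : ((‖∑ j, if f j = k then star (ψ j) * w j else 0‖ ^ 2 : ℝ) : ℂ) =
        ∑ i, ∑ j, if f i = k then
          (if f j = k then star (w i) * (ψ i * star (ψ j) * w j) else 0) else 0 := by
      rw [Complex.ofReal_pow, ← Complex.conj_mul', map_sum, Finset.sum_mul_sum]
      refine Finset.sum_congr rfl fun i _ => Finset.sum_congr rfl fun j _ => ?_
      split_ifs <;> simp
      ring
    rw [Complex.ofReal_sum, Finset.sum_congr rfl fun k _ => hk k, Finset.sum_comm]
    simp only [dotProduct, Matrix.mulVec, measureMap_blockProj_apply, Finset.mul_sum]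
    refine Finset.sum_congr rfl fun i _ => ?_
    rw [Finset.sum_comm]
    refine Finset.sum_congr rfl fun j _ => ?_
    simp [pureState, Matrix.vecMulVec_apply, eq_comm (a := f j)]
  rw [Matrix.sub_mulVec, h1, zero_sub, dotProduct_neg, h2, Complex.neg_re, Complex.ofReal_re]
  exact neg_nonpos.mpr (Finset.sum_nonneg fun _ _ => by positivity)

lemma blockInfidelity_le_disturbance (f : n → κ) {ψ : n → ℂ} (hψ : ∑ i, ‖ψ i‖ ^ 2 = 1) :
    blockInfidelity f ψ ≤ disturbance (measureMap (blockProj f)) ψ := by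
  have h := re_expectation_le_half_traceNorm
    (isHermitian_pureState_sub_measureMap_blockProj f ψ)
    (trace_pureState_sub_measureMap_blockProj f ψ) hψ
  rwa [expectation_pureState_sub_measureMap_blockProj, Complex.ofReal_re] at h

lemma disturbance_sq_le_blockInfidelity (f : n → κ) (ψ : n → ℂ) :
    disturbance (measureMap (blockProj f)) ψ ^ 2 ≤ blockInfidelity f ψ := by
  have h := half_traceNorm_sq_le_trace_mul_self
    (isHermitian_pureState_sub_measureMap_blockProj f ψ)
    (trace_pureState_sub_measureMap_blockProj f ψ)
    (expectation_pureState_sub_measureMap_blockProj_nonpos f ψ)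
  rwa [trace_sq_pureState_sub_measureMap_blockProj, Complex.ofReal_re] at h

end Pinching

section Average

variable {n : Type*} [Fintype n] [DecidableEq n] {κ : Type*} [Fintype κ] [DecidableEq κ]

/-! ### The three classes of measurements as rotated pinchings -/

lemma completeMeasurements_eq_conj {Λ : Matrix n n ℂ → Matrix n n ℂ}
    (hΛ : Λ ∈ completeMeasurements n) : ∃ V : Matrix.unitaryGroup n ℂ,
      Λ = measureMap fun k => (V : Matrix n n ℂ) * blockProj id k * (V : Matrix n n ℂ)ᴴ := by
  obtain ⟨b, rfl⟩ := hΛ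
  refine ⟨basisUnitary b, congrArg _ (funext fun k => ?_)⟩
  rw [basisProj_eq_conj, blockProj]
  congr 3
  funext i
  simp [Pi.single_apply]

variable {a b : Type*} [Fintype a] [DecidableEq a] [Fintype b] [DecidableEq b]

lemma localMeasurements_eq_conj {Λ : Matrix (a × b) (a × b) ℂ → Matrix (a × b) (a × b) ℂ}
    (hΛ : Λ ∈ localMeasurements a b) : ∃ V : Matrix.unitaryGroup (a × b) ℂ,
      Λ = measureMap fun k => (V : Matrix (a × b) (a × b) ℂ) * blockProj Prod.fst k *
        (V : Matrix (a × b) (a × b) ℂ)ᴴ := by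
  obtain ⟨u, rfl⟩ := hΛ
  refine ⟨⟨_, Matrix.kronecker_mem_unitary (basisUnitary u).2 (one_mem (Matrix.unitaryGroup b ℂ))⟩,
    congrArg _ (funext fun k => ?_)⟩
  have hd : (blockProj Prod.fst k : Matrix (a × b) (a × b) ℂ) =
      Matrix.diagonal (Pi.single k 1) ⊗ₖ (1 : Matrix b b ℂ) := by
    rw [blockProj, ← Matrix.diagonal_one, Matrix.diagonal_kronecker_diagonal]
    congr 1
    funext i
    simp [Pi.single_apply]
  simp only [hd, Matrix.conjTranspose_kronecker, ← Matrix.mul_kronecker_mul, basisProj_eq_conj,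
    Matrix.conjTranspose_one, mul_one]

lemma bilocalMeasurements_eq_conj {Λ : Matrix (a × b) (a × b) ℂ → Matrix (a × b) (a × b) ℂ}
    (hΛ : Λ ∈ bilocalMeasurements a b) : ∃ V : Matrix.unitaryGroup (a × b) ℂ,
      Λ = measureMap fun k => (V : Matrix (a × b) (a × b) ℂ) * blockProj id k *
        (V : Matrix (a × b) (a × b) ℂ)ᴴ := by
  obtain ⟨u, v, rfl⟩ := hΛ
  refine ⟨⟨_, Matrix.kronecker_mem_unitary (basisUnitary u).2 (basisUnitary v).2⟩,
    congrArg _ (funext fun k => ?_)⟩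
  have hd : (blockProj id k : Matrix (a × b) (a × b) ℂ) =
      Matrix.diagonal (Pi.single k.1 1) ⊗ₖ Matrix.diagonal (Pi.single k.2 1) := by
    rw [blockProj, Matrix.diagonal_kronecker_diagonal]
    congr 1
    funext i
    rcases eq_or_ne i.1 k.1 with h | h <;> simp [Pi.single_apply, Prod.ext_iff, h]
  simp only [hd, Matrix.conjTranspose_kronecker, ← Matrix.mul_kronecker_mul, basisProj_eq_conj]

/-! ### Averages over the Haar-uniform ensemble -/

lemma continuous_disturbance_measureMap {κ : Type*} [Fintype κ] (P : κ → Matrix n n ℂ) :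
    Continuous (disturbance (measureMap P)) := by
  have hp : Continuous (pureState : (n → ℂ) → Matrix n n ℂ) :=
    continuous_id.matrix_vecMulVec continuous_star
  have hm : Continuous fun ψ : n → ℂ => measureMap P (pureState ψ) :=
    continuous_finsetSum _ fun k _ =>
      (continuous_const.matrix_mul hp).matrix_mul continuous_const
  exact continuous_const.mul (continuous_traceNorm.comp (hp.sub hm))

/-- Rotating both the measurement and the state leaves the disturbance unchanged. -/
lemma disturbance_conj_mulVec {κ : Type*} [Fintype κ] (V : Matrix.unitaryGroup n ℂ)
    (P : κ → Matrix n n ℂ) (ψ : n → ℂ) :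
    disturbance (measureMap fun k => (V : Matrix n n ℂ) * P k * (V : Matrix n n ℂ)ᴴ)
      ((V : Matrix n n ℂ) *ᵥ ψ) = disturbance (measureMap P) ψ := by
  have hV : (V : Matrix n n ℂ)ᴴ * (V : Matrix n n ℂ) = 1 := Unitary.coe_star_mul_self V
  have hp : pureState ((V : Matrix n n ℂ) *ᵥ ψ) =
      (V : Matrix n n ℂ) * pureState ψ * (V : Matrix n n ℂ)ᴴ := by
    rw [pureState, pureState, Matrix.mul_vecMulVec, Matrix.vecMulVec_mul, Matrix.star_mulVec]
  have hm : measureMap (fun k => (V : Matrix n n ℂ) * P k * (V : Matrix n n ℂ)ᴴ)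
      (pureState ((V : Matrix n n ℂ) *ᵥ ψ)) =
      (V : Matrix n n ℂ) * measureMap P (pureState ψ) * (V : Matrix n n ℂ)ᴴ := by
    rw [hp, measureMap, measureMap, Finset.mul_sum, Finset.sum_mul]
    refine Finset.sum_congr rfl fun k _ => ?_
    calc _ = (V : Matrix n n ℂ) * P k * ((V : Matrix n n ℂ)ᴴ * (V : Matrix n n ℂ)) *
          pureState ψ * ((V : Matrix n n ℂ)ᴴ * (V : Matrix n n ℂ)) * P k *
          (V : Matrix n n ℂ)ᴴ := by simp only [mul_assoc]
      _ = _ := by rw [hV, mul_one, mul_one]; simp only [mul_assoc]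
  rw [disturbance, disturbance, traceDist, traceDist, hm, hp, ← Matrix.sub_mul, ← Matrix.mul_sub,
    traceNorm_conj_unitary]

lemma continuous_blockInfidelity {n κ : Type*} [Fintype n] [DecidableEq κ] (f : n → κ) :
    Continuous (blockInfidelity f) :=
  continuous_finsetSum _ fun i _ => continuous_finsetSum _ fun j _ => by
    split_ifs
    · exact continuous_const
    · fun_prop

lemma blockInfidelity_nonneg {n κ : Type*} [Fintype n] [DecidableEq κ] (f : n → κ) (ψ : n → ℂ) :
    0 ≤ blockInfidelity f ψ :=
  Finset.sum_nonneg fun _ _ => Finset.sum_nonneg fun _ _ => by split_ifs <;> positivity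

lemma blockInfidelity_le_one {n κ : Type*} [Fintype n] [DecidableEq κ] (f : n → κ)
    {ψ : n → ℂ} (hψ : ∑ i, ‖ψ i‖ ^ 2 = 1) :
    blockInfidelity f ψ ≤ 1 := by
  calc blockInfidelity f ψ ≤ ∑ i, ∑ j, ‖ψ i‖ ^ 2 * ‖ψ j‖ ^ 2 :=
        Finset.sum_le_sum fun i _ => Finset.sum_le_sum fun j _ => by
          split_ifs
          · positivity
          · exact le_rfl
    _ = 1 := by rw [← Finset.sum_mul_sum, hψ, one_mul]

variable [Nonempty n]

lemma integrable_blockInfidelity {κ : Type*} [DecidableEq κ] (f : n → κ) :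
    Integrable (blockInfidelity f) (haarPureStates n) :=
  integrable_haarPureStates_of_bound (continuous_blockInfidelity f) 1 fun ψ hψ => by
    rw [abs_of_nonneg (blockInfidelity_nonneg f ψ)]
    exact blockInfidelity_le_one f hψ

lemma integrable_disturbance_blockProj (f : n → κ) :
    Integrable (disturbance (measureMap (blockProj f))) (haarPureStates n) :=
  integrable_haarPureStates_of_bound (continuous_disturbance_measureMap _) 1 fun ψ hψ =>
    (sq_le_one_iff_abs_le_one _).mp
      ((disturbance_sq_le_blockInfidelity f ψ).trans (blockInfidelity_le_one f hψ))

lemma integral_blockInfidelity {κ : Type*} [DecidableEq κ] (f : n → κ) :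
    ∫ ψ, blockInfidelity f ψ ∂haarPureStates n =
      1 - (Fintype.card n + ∑ i, ∑ j, if f i = f j then 1 else 0 : ℝ) /
        (Fintype.card n * (Fintype.card n + 1)) := by
  have hint (i j : n) : Integrable (fun ψ : n → ℂ =>
      if f i = f j then 0 else ‖ψ i‖ ^ 2 * ‖ψ j‖ ^ 2) (haarPureStates n) := by
    split_ifs
    · exact integrable_const 0
    · exact integrable_norm_sq_mul_norm_sq i j
  have hval (i j : n) : ∫ ψ, (if f i = f j then 0 else ‖ψ i‖ ^ 2 * ‖ψ j‖ ^ 2) ∂haarPureStates n =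
      (1 - if f i = f j then 1 else 0) / (Fintype.card n * (Fintype.card n + 1) : ℝ) := by
    by_cases h : f i = f j
    · simp [h]
    · have hij : i ≠ j := fun e => h (congrArg f e)
      simp only [if_neg h]
      rw [integral_norm_sq_mul_norm_sq, if_neg hij, add_zero, sub_zero]
  have hN : (0 : ℝ) < Fintype.card n := by exact_mod_cast Fintype.card_pos
  simp only [blockInfidelity]
  rw [integral_finsetSum _ fun i _ => integrable_finsetSum _ fun j _ => hint i j]
  simp only [integral_finsetSum _ fun j _ => hint _ j, hval, ← Finset.sum_div,
    Finset.sum_sub_distrib, Finset.sum_const, Finset.card_univ, nsmul_eq_mul, mul_one]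
  field_simp
  ring

lemma integral_blockInfidelity_le_avgDisturbance (f : n → κ) :
    ∫ ψ, blockInfidelity f ψ ∂haarPureStates n ≤
      avgDisturbance (haarPureStates n) (measureMap (blockProj f)) :=
  integral_mono_ae (integrable_blockInfidelity f) (integrable_disturbance_blockProj f)
    (ae_sum_norm_sq_eq_one.mono fun _ hψ => blockInfidelity_le_disturbance f hψ)

lemma avgDisturbance_le_sqrt_integral_blockInfidelity (f : n → κ) :
    avgDisturbance (haarPureStates n) (measureMap (blockProj f)) ≤
      √(∫ ψ, blockInfidelity f ψ ∂haarPureStates n) := by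
  set D := disturbance (measureMap (blockProj f))
  set c := avgDisturbance (haarPureStates n) (measureMap (blockProj f)) with hc
  have hD := integrable_disturbance_blockProj f
  have hB := integrable_blockInfidelity f
  have hlin : Integrable (fun ψ => 2 * c * D ψ - c ^ 2) (haarPureStates n) :=
    (hD.const_mul _).sub (integrable_const _)
  apply Real.le_sqrt_of_sq_le
  -- Jensen's inequality, from `2 * c * x - c ^ 2 ≤ x ^ 2` with `c` the mean
  calc c ^ 2 = ∫ ψ, (2 * c * D ψ - c ^ 2) ∂haarPureStates n := by
        rw [integral_sub (hD.const_mul _) (integrable_const _), integral_const_mul,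
          show ∫ ψ, D ψ ∂haarPureStates n = c from rfl]
        simp
        ring
    _ ≤ _ := by
        refine integral_mono hlin hB fun ψ => ?_
        have h1 : D ψ ^ 2 ≤ blockInfidelity f ψ := disturbance_sq_le_blockInfidelity f ψ
        have h2 := sq_nonneg (D ψ - c)
        simp only
        linarith

/-- A class of measurements that are all unitarily equivalent to one pinching in the standard
basis: by invariance of the ensemble they all have the same average disturbance. -/
lemma quantumness_of_unitarily_equivalent_pinching (f : n → κ)
    {L : Set (Matrix n n ℂ → Matrix n n ℂ)} (hne : L.Nonempty)
    (hL : ∀ Λ ∈ L, ∃ V : Matrix.unitaryGroup n ℂ,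
      Λ = measureMap fun k => (V : Matrix n n ℂ) * blockProj f k * (V : Matrix n n ℂ)ᴴ)
    {r : ℝ} (hr : (Fintype.card n + ∑ i, ∑ j, if f i = f j then 1 else 0 : ℝ) /
      (Fintype.card n * (Fintype.card n + 1)) = r) :
    (∀ Λ ∈ L, Integrable (disturbance Λ) (haarPureStates n) ∧
      avgDisturbance (haarPureStates n) Λ = quantumness (haarPureStates n) L) ∧
    IsLeast (avgDisturbance (haarPureStates n) '' L) (quantumness (haarPureStates n) L) ∧
    1 - r ≤ quantumness (haarPureStates n) L ∧
    quantumness (haarPureStates n) L ≤ √(1 - r) := by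
  set c := avgDisturbance (haarPureStates n) (measureMap (blockProj f))
  have hconst : ∀ Λ ∈ L, Integrable (disturbance Λ) (haarPureStates n) ∧
      avgDisturbance (haarPureStates n) Λ = c := by
    intro Λ hΛ
    obtain ⟨V, rfl⟩ := hL Λ hΛ
    have hcont := continuous_disturbance_measureMap
      fun k => (V : Matrix n n ℂ) * blockProj f k * (V : Matrix n n ℂ)ᴴ
    constructor
    · rw [← (measurePreserving_unitary_mulVec V).integrable_comp hcont.aestronglyMeasurable]
      refine (integrable_disturbance_blockProj f).congr (Filter.Eventually.of_forall fun ψ => ?_)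
      exact (disturbance_conj_mulVec V _ ψ).symm
    · rw [avgDisturbance, ← integral_comp_unitary_mulVec V hcont]
      simp only [disturbance_conj_mulVec]
      rfl
  have himage : avgDisturbance (haarPureStates n) '' L = {c} := by
    refine Set.Subset.antisymm ?_ ?_
    · rintro _ ⟨Λ, hΛ, rfl⟩
      exact (hconst Λ hΛ).2
    · rintro _ rfl
      obtain ⟨Λ, hΛ⟩ := hne
      exact ⟨Λ, hΛ, (hconst Λ hΛ).2⟩
  have hq : quantumness (haarPureStates n) L = c := by rw [quantumness, himage, csInf_singleton]
  rw [hq, himage]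
  refine ⟨hconst, isLeast_singleton, ?_, ?_⟩
  · rw [← hr, ← integral_blockInfidelity]
    exact integral_blockInfidelity_le_avgDisturbance f
  · rw [← hr, ← integral_blockInfidelity]
    exact avgDisturbance_le_sqrt_integral_blockInfidelity f

/-! ### Expansion in large dimension -/

lemma sqrt_one_sub_two_div_sub_isBigO :
    (fun m : ℕ => √(1 - 2 / ((m : ℝ) + 1)) - (1 - 1 / ((m : ℝ) + 1)))
      =O[Filter.atTop] fun m : ℕ => ((m : ℝ) ^ 2)⁻¹ := by
  refine Asymptotics.IsBigO.of_bound 2 ?_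
  filter_upwards [Filter.eventually_ge_atTop 1] with m hm
  have hm' : (1 : ℝ) ≤ m := by exact_mod_cast hm
  set x : ℝ := 1 / ((m : ℝ) + 1) with hx
  have hx0 : 0 < x := by positivity
  have hx2 : x ≤ 1 / 2 := by
    rw [hx]; gcongr; linarith
  have h2 : 2 / ((m : ℝ) + 1) = 2 * x := by rw [hx]; ring
  have hxm : x ^ 2 ≤ ((m : ℝ) ^ 2)⁻¹ := by
    rw [hx, one_div, inv_pow]; gcongr; linarith
  rw [h2, Real.norm_eq_abs, Real.norm_eq_abs, abs_of_nonneg (by positivity : 0 ≤ ((m : ℝ) ^ 2)⁻¹)]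
  have hs0 := Real.sqrt_nonneg (1 - 2 * x)
  have hsq : √(1 - 2 * x) ^ 2 = 1 - 2 * x := Real.sq_sqrt (by linarith)
  set s := √(1 - 2 * x)
  have hle : s ≤ 1 - x := by nlinarith
  rw [abs_of_nonpos (by linarith)]
  -- `(1 - x - s) * (1 - x + s) = x ^ 2`, and the second factor is at least `1 / 2`
  nlinarith

end Average

end HaarDisturbance

theorem mainTheorem10 (d dA dB : ℕ) [NeZero d] [NeZero dA] [NeZero dB] :
    -- single system of dimension `d`
    ((∀ Λ ∈ completeMeasurements (Fin d),
        Integrable (disturbance Λ) (haarPureStates (Fin d)) ∧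
        avgDisturbance (haarPureStates (Fin d)) Λ =
          quantumness (haarPureStates (Fin d)) (completeMeasurements (Fin d))) ∧
      IsLeast (avgDisturbance (haarPureStates (Fin d)) '' completeMeasurements (Fin d))
        (quantumness (haarPureStates (Fin d)) (completeMeasurements (Fin d))) ∧
      1 - 2 / ((d : ℝ) + 1) ≤
        quantumness (haarPureStates (Fin d)) (completeMeasurements (Fin d)) ∧
      quantumness (haarPureStates (Fin d)) (completeMeasurements (Fin d)) ≤
        Real.sqrt (1 - 2 / ((d : ℝ) + 1))) ∧
    -- one-sided measurements on a bipartite system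
    ((∀ Λ ∈ localMeasurements (Fin dA) (Fin dB),
        Integrable (disturbance Λ) (haarPureStates (Fin dA × Fin dB)) ∧
        avgDisturbance (haarPureStates (Fin dA × Fin dB)) Λ =
          quantumness (haarPureStates (Fin dA × Fin dB))
            (localMeasurements (Fin dA) (Fin dB))) ∧
      IsLeast
        (avgDisturbance (haarPureStates (Fin dA × Fin dB)) ''
          localMeasurements (Fin dA) (Fin dB))
        (quantumness (haarPureStates (Fin dA × Fin dB))
          (localMeasurements (Fin dA) (Fin dB))) ∧
      1 - ((dB : ℝ) + 1) / ((dA : ℝ) * (dB : ℝ) + 1) ≤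
        quantumness (haarPureStates (Fin dA × Fin dB))
          (localMeasurements (Fin dA) (Fin dB)) ∧
      quantumness (haarPureStates (Fin dA × Fin dB))
          (localMeasurements (Fin dA) (Fin dB)) ≤
        Real.sqrt (1 - ((dB : ℝ) + 1) / ((dA : ℝ) * (dB : ℝ) + 1))) ∧
    -- two-sided measurements on a bipartite system
    ((∀ Λ ∈ bilocalMeasurements (Fin dA) (Fin dB),
        Integrable (disturbance Λ) (haarPureStates (Fin dA × Fin dB)) ∧
        avgDisturbance (haarPureStates (Fin dA × Fin dB)) Λ =
          quantumness (haarPureStates (Fin dA × Fin dB))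
            (bilocalMeasurements (Fin dA) (Fin dB))) ∧
      IsLeast
        (avgDisturbance (haarPureStates (Fin dA × Fin dB)) ''
          bilocalMeasurements (Fin dA) (Fin dB))
        (quantumness (haarPureStates (Fin dA × Fin dB))
          (bilocalMeasurements (Fin dA) (Fin dB))) ∧
      1 - 2 / ((dA : ℝ) * (dB : ℝ) + 1) ≤
        quantumness (haarPureStates (Fin dA × Fin dB))
          (bilocalMeasurements (Fin dA) (Fin dB)) ∧
      quantumness (haarPureStates (Fin dA × Fin dB))
          (bilocalMeasurements (Fin dA) (Fin dB)) ≤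
        Real.sqrt (1 - 2 / ((dA : ℝ) * (dB : ℝ) + 1))) ∧
    -- expansion of the single-system upper bound for large dimension
    ((fun m : ℕ => Real.sqrt (1 - 2 / ((m : ℝ) + 1)) - (1 - 1 / ((m : ℝ) + 1)))
      =O[Filter.atTop] fun m : ℕ => ((m : ℝ) ^ 2)⁻¹) := by
  have hd : (d : ℝ) ≠ 0 := Nat.cast_ne_zero.mpr (NeZero.ne d)
  have hA : (dA : ℝ) ≠ 0 := Nat.cast_ne_zero.mpr (NeZero.ne dA)
  have hB : (dB : ℝ) ≠ 0 := Nat.cast_ne_zero.mpr (NeZero.ne dB)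
  have h1 := quantumness_of_unitarily_equivalent_pinching (n := Fin d) id
      (L := completeMeasurements (Fin d)) ⟨_, EuclideanSpace.basisFun _ ℂ, rfl⟩
      (fun Λ hΛ => completeMeasurements_eq_conj hΛ) (r := 2 / ((d : ℝ) + 1)) (by
        simp
        field_simp
        ring)
  have h2 := quantumness_of_unitarily_equivalent_pinching (n := Fin dA × Fin dB) Prod.fst
      (L := localMeasurements (Fin dA) (Fin dB)) ⟨_, EuclideanSpace.basisFun _ ℂ, rfl⟩
      (fun Λ hΛ => localMeasurements_eq_conj hΛ)
      (r := ((dB : ℝ) + 1) / ((dA : ℝ) * (dB : ℝ) + 1)) (by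
        have hsum (p : Fin dA × Fin dB) :
            ∑ q : Fin dA × Fin dB, (if p.1 = q.1 then 1 else 0 : ℝ) = dB := by
          rw [Fintype.sum_prod_type' fun x _ => (if p.1 = x then 1 else 0 : ℝ)]
          simp
        simp only [hsum]
        simp
        field_simp
        ring)
  have h3 := quantumness_of_unitarily_equivalent_pinching (n := Fin dA × Fin dB) id
      (L := bilocalMeasurements (Fin dA) (Fin dB))
      ⟨_, EuclideanSpace.basisFun _ ℂ, EuclideanSpace.basisFun _ ℂ, rfl⟩
      (fun Λ hΛ => bilocalMeasurements_eq_conj hΛ) (r := 2 / ((dA : ℝ) * (dB : ℝ) + 1)) (by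
        simp
        field_simp
        ring)
  exact ⟨h1, h2, h3, sqrt_one_sub_two_div_sub_isBigO⟩
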